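/- Let $z_0\in\mathbb C$, $v_0\in\mathbb R$, $a>0$ and $b\in(0,2)$, and put \[\Omega=\Omega_{a,b}(z_0,v_0):=\{(z,w)\in\mathbb C^2:\ a|z-z_0|^2+2e^{-1/|w-v_0|^2}<b\},\] where $e^{-1/|w-v_0|^2}$ is understood to be $0$ at $w=v_0$. A defining function of $\Omega$ is a function $\rho\in C^\infty(\mathbb C^2,\mathbb R)$ with $\Omega=\{\rho<0\}$, $\partial\Omega=\{\rho=0\}$ and $\nabla\rho\neq0$ on $\partial\Omega$. A holomorphic tangent vector to $\partial\Omega$ at $p\in\partial\Omega$ is a vector $L=f\,\partial_z+g\,\partial_w$ with $L\rho(p)=0$. A point of $\partial\Omega$ is Levi-flat if the Levi form (the complex Hessian of $\rho$ restricted to holomorphic tangent vectors) vanishes there; $\Omega$ is pseudoconvex if the Levi form is nonnegative at all points of $\partial\Omega$. The Diederich--Fornæss index of $\Omega$ is the supremum of all $\tau\in(0,1)$ for which there is a defining function $\rho$ of $\Omega$ such that $-(-\rho)^{\tau}$ is plurisubharmonic on $\Omega$. Then: 1. $\Omega$ is a bounded domain with smooth boundary (in particular it has a defining function), and it is pseudoconvex.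 2. With respect to every defining function, the set of Levi-flat points of $\partial\Omega$ is exactly the circle \[\mathcal F=\Big\{(z,w)\in\mathbb C^2:\ |z-z_0|=\sqrt{b/a},\ w=v_0\Big\}.\] 3. $\mathcal F$ is a simple closed real curve with a smooth regular periodic parametrization $\gamma$ that is transversal to the holomorphic tangent vectors of $\partial\Omega$: for every $t$ and every nonzero holomorphic tangent vector $L$ to $\partial\Omega$ at $\gamma(t)$, the real vectors $\gamma'(t)$, $\operatorname{Re}L$ and $\operatorname{Im}L$ are linearly independent over $\mathbb R$. 4. The Diederich--Fornæss index of $\Omega$ is $1$. -/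

import Mathlib

open scoped ContDiff

noncomputable section

/-- The derivative `Z f` of `f` at `p` along the constant holomorphic vector field
`Z = v.1 ∂/∂z + v.2 ∂/∂w`, that is `Z = (X - i J X) / 2` for the real vector `X = v`. -/
def holDeriv (f : ℂ × ℂ → ℂ) (p v : ℂ × ℂ) : ℂ :=
  (1 / 2) * (fderiv ℝ f p v - Complex.I * fderiv ℝ f p (Complex.I • v))

/-- The derivative of `f` at `p` along the conjugate field `(X + i J X) / 2`, `X = v`. -/
def antiholDeriv (f : ℂ × ℂ → ℂ) (p v : ℂ × ℂ) : ℂ :=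
  (1 / 2) * (fderiv ℝ f p v + Complex.I * fderiv ℝ f p (Complex.I • v))

/-- The complex Hessian `Hess_f(V, W) = V (conj W f)` of a real function `f` at `p`, for the
constant holomorphic vector fields with coefficients `v` and `w`; in coordinates it is
`∑ j k, f_{j k̄} v_j conj (w_k)`. -/
def complexHessian (f : ℂ × ℂ → ℝ) (p v w : ℂ × ℂ) : ℂ :=
  holDeriv (fun q => antiholDeriv (fun x => (f x : ℂ)) q w) p v

/-- `ρ` is a (smooth, global) defining function of `Ω`: `Ω = {ρ < 0}`, `∂Ω = {ρ = 0}`, and the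
gradient of `ρ` does not vanish on `∂Ω`. -/
structure IsDefiningFunction (Ω : Set (ℂ × ℂ)) (ρ : ℂ × ℂ → ℝ) : Prop where
  smooth : ContDiff ℝ ∞ ρ
  eq_neg : Ω = {p | ρ p < 0}
  frontier_eq : frontier Ω = {p | ρ p = 0}
  fderiv_ne_zero : ∀ p ∈ frontier Ω, fderiv ℝ ρ p ≠ 0

/-- A bounded domain with smooth boundary in `ℂ²`. -/
structure IsBoundedSmoothDomain (Ω : Set (ℂ × ℂ)) : Prop where
  isOpen : IsOpen Ω
  isConnected : IsConnected Ω
  isBounded : Bornology.IsBounded Ω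
  exists_defining : ∃ ρ, IsDefiningFunction Ω ρ

/-- `v` gives the coefficients of a holomorphic tangent vector `L = v.1 ∂/∂z + v.2 ∂/∂w`,
`L ρ = 0`, to the boundary `{ρ = 0}` at `p`. -/
def IsHolTangent (ρ : ℂ × ℂ → ℝ) (p v : ℂ × ℂ) : Prop :=
  holDeriv (fun x => (ρ x : ℂ)) p v = 0

/-- The boundary of `Ω` is (Levi) pseudoconvex: the Levi form of a defining function `ρ` is
nonnegative on holomorphic tangent vectors at boundary points. (For smooth `ρ` the number
`complexHessian ρ p v v` is real.) -/
def IsLeviPseudoconvex (Ω : Set (ℂ × ℂ)) (ρ : ℂ × ℂ → ℝ) : Prop :=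
  ∀ p ∈ frontier Ω, ∀ v, IsHolTangent ρ p v → 0 ≤ (complexHessian ρ p v v).re

/-- The set of Levi-flat points: the boundary points of `Ω` at which the Levi form of the defining
function `ρ` vanishes on the holomorphic tangent space. -/
def leviFlatSet (Ω : Set (ℂ × ℂ)) (ρ : ℂ × ℂ → ℝ) : Set (ℂ × ℂ) :=
  {p ∈ frontier Ω | ∀ v, IsHolTangent ρ p v → complexHessian ρ p v v = 0}

/-- The `C^∞` map `γ`, of period `T > 0` and with nowhere vanishing velocity, parametrizes
the set `S` as a simple closed real curve. -/
structure IsSimpleClosedParam (γ : ℝ → ℂ × ℂ) (T : ℝ) (S : Set (ℂ × ℂ)) : Prop where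
  smooth : ContDiff ℝ ∞ γ
  deriv_ne_zero : ∀ t, deriv γ t ≠ 0
  period_pos : 0 < T
  periodic : Function.Periodic γ T
  simple : Set.InjOn γ (Set.Ico 0 T)
  range_eq : Set.range γ = S

/-- The real vector `Re L` for `L = v.1 ∂/∂z + v.2 ∂/∂w`: `2 Re L` has the real coordinates of
`v`. -/
def holRe (v : ℂ × ℂ) : ℂ × ℂ := (1 / 2 : ℂ) • v

/-- The real vector `Im L` for `L = v.1 ∂/∂z + v.2 ∂/∂w`: `2 Im L` has the real coordinates of
`-i v`. -/
def holIm (v : ℂ × ℂ) : ℂ × ℂ := (-Complex.I / 2 : ℂ) • v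

/-- The real vector `u` (the velocity of a real curve) is transversal to the holomorphic vector
`L` with coefficients `v`: the vectors `u`, `Re L`, `Im L` are linearly independent over `ℝ`. -/
def IsTransversal (u v : ℂ × ℂ) : Prop :=
  LinearIndependent ℝ ![u, holRe v, holIm v]

/-- `f`, of class `C²` on the open set `Ω`, is plurisubharmonic there: its complex Hessian
is positive semidefinite at every point. -/
def IsPlurisubharmonicOn (f : ℂ × ℂ → ℝ) (Ω : Set (ℂ × ℂ)) : Prop :=
  ContDiffOn ℝ 2 f Ω ∧ ∀ p ∈ Ω, ∀ v, 0 ≤ (complexHessian f p v v).re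

/-- `τ ∈ (0, 1)` is a Diederich–Fornæss exponent of `Ω`: `-(-ρ)^τ` is plurisubharmonic on `Ω`
for some defining function `ρ` of `Ω`. -/
def IsDFExponent (Ω : Set (ℂ × ℂ)) (τ : ℝ) : Prop :=
  0 < τ ∧ τ < 1 ∧ ∃ ρ, IsDefiningFunction Ω ρ ∧ IsPlurisubharmonicOn (fun p => -(-ρ p) ^ τ) Ω

/-- The Diederich–Fornæss index: the supremum of all exponents (a set bounded by `1`). -/
def dfIndex (Ω : Set (ℂ × ℂ)) : ℝ := sSup {τ | IsDFExponent Ω τ}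

/-- The domain `Ω_{a,b}(p)`, `p = (z₀, v₀)`, given by
`a |z - z₀|² + 2 exp (-1 / |w - v₀|²) < b`. The exponential term is continued by its limit `0`
at `w = v₀`: `expNegInvGlue x` is `exp (-1 / x)` for `x > 0` and `0` for `x ≤ 0`. -/
def domainOmega (a b : ℝ) (z₀ : ℂ) (v₀ : ℝ) : Set (ℂ × ℂ) :=
  {p | a * ‖p.1 - z₀‖ ^ 2 + 2 * expNegInvGlue (‖p.2 - (v₀ : ℂ)‖ ^ 2) < b}

end

open scoped ContDiff

/-! Write `r` for the function `omegaFun`, `s = |w - v₀|²` and `φ = exp (-1/s)`. Its complex Hessian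
is diagonal, with entries `a` and `2 (s⁻³ - s⁻²) φ`; the second is negative for `s > 1`, so `r`
itself need not be plurisubharmonic. The key estimate `omegaHess_add_nonneg` compensates with the
gradient: `Hess r + (2 - b)⁻¹ |∂r|² ≥ 0` wherever `r ≤ 0`, that is, `exp (r / (2 - b))` has
nonnegative complex Hessian there. It rests on Cauchy–Schwarz and on `s - 1 ≤ s φ`, a form of `1 + x
≤ exp x`.

On tangent vectors `∂r = 0`, so the estimate gives pseudoconvexity. With `K = (2 - b)⁻¹`, the single
defining function `exp (K r) - 1` makes every `τ` in `(0, 1)` an exponent, so the index is `1`. Off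
`w = v₀` the Levi form is computed on an explicit tangent vector and is positive; on `w = v₀` the
tangent space is the `w`-axis, where the Hessian vanishes because `φ` is flat at `0`.

Passing to an arbitrary defining function needs Levi forms to be positively proportional.
`IsDefiningFunction.exists_complexHessian_eq` gets this from signs alone, by testing along
parabolas, without factoring one function through the other. -/

/-- The complex Hessian of a real function as an average of real Hessians. -/
theorem complexHessian_self {f : ℂ × ℂ → ℝ} {p : ℂ × ℂ} (hf : ContDiffAt ℝ 2 f p) (v : ℂ × ℂ) :
    complexHessian f p v v =
      ((1 / 4 * (fderiv ℝ (fderiv ℝ f) p v v +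
        fderiv ℝ (fderiv ℝ f) p (Complex.I • v) (Complex.I • v)) : ℝ) : ℂ) := by
  have hd : DifferentiableAt ℝ (fderiv ℝ f) p :=
    (hf.fderiv_right (m := 1) (by norm_num)).differentiableAt (by norm_num)
  have hsymm : IsSymmSndFDerivAt ℝ f p := hf.isSymmSndFDerivAt (by simp)
  have key : HasFDerivAt (fun q => (1 / 2 : ℂ) * ((fderiv ℝ f q v : ℂ) +
      Complex.I * (fderiv ℝ f q (Complex.I • v) : ℂ)))
      ((1 / 2 : ℂ) • ((Complex.ofRealCLM.comp ((fderiv ℝ (fderiv ℝ f) p).flip v)) +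
        Complex.I • (Complex.ofRealCLM.comp ((fderiv ℝ (fderiv ℝ f) p).flip (Complex.I • v)))))
      p := by
    have h1 : ∀ u : ℂ × ℂ, HasFDerivAt (fun q => (fderiv ℝ f q u : ℂ))
        (Complex.ofRealCLM.comp ((fderiv ℝ (fderiv ℝ f) p).flip u)) p := by
      intro u
      have h2 : HasFDerivAt (fun q => fderiv ℝ f q u) ((fderiv ℝ (fderiv ℝ f) p).flip u) p := by
        simpa using hd.hasFDerivAt.clm_apply (hasFDerivAt_const u p)
      exact Complex.ofRealCLM.hasFDerivAt.comp p h2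
    exact ((h1 v).add ((h1 (Complex.I • v)).const_mul Complex.I)).const_mul _
  have hev : (fun q => antiholDeriv (fun x => (f x : ℂ)) q v) =ᶠ[nhds p]
      (fun q => (1 / 2 : ℂ) * ((fderiv ℝ f q v : ℂ) +
      Complex.I * (fderiv ℝ f q (Complex.I • v) : ℂ))) := by
    filter_upwards [hf.eventually (by simp)] with q hq
    have h3 : fderiv ℝ (fun x => (f x : ℂ)) q = Complex.ofRealCLM.comp (fderiv ℝ f q) :=
      (Complex.ofRealCLM.hasFDerivAt.comp q
        (hq.differentiableAt (by norm_num)).hasFDerivAt).fderiv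
    simp [antiholDeriv, h3]
  unfold complexHessian holDeriv
  rw [hev.fderiv_eq, key.fderiv]
  have hs := hsymm v (Complex.I • v)
  simp only [smul_apply, add_apply,
    ContinuousLinearMap.comp_apply, ContinuousLinearMap.flip_apply, Complex.ofRealCLM_apply,
    smul_eq_mul, hs]
  push_cast
  linear_combination (-(1 / 4 : ℂ) * (fderiv ℝ (fderiv ℝ f) p (Complex.I • v) (Complex.I • v) : ℂ))
    * Complex.I_sq

/-- Holomorphic tangency in terms of the real differential. -/
theorem isHolTangent_iff {f : ℂ × ℂ → ℝ} {p v : ℂ × ℂ} (hf : DifferentiableAt ℝ f p) :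
    IsHolTangent f p v ↔ fderiv ℝ f p v = 0 ∧ fderiv ℝ f p (Complex.I • v) = 0 := by
  have h3 : fderiv ℝ (fun x => (f x : ℂ)) p = Complex.ofRealCLM.comp (fderiv ℝ f p) :=
    (Complex.ofRealCLM.hasFDerivAt.comp p hf.hasFDerivAt).fderiv
  simp [IsHolTangent, holDeriv, h3, Complex.ext_iff]

/-! ### Second-order comparison of functions with the same signs. -/

section Comparison

variable {E : Type*} [NormedAddCommGroup E] [NormedSpace ℝ E]

theorem hasDerivAt_comp_parabola {f : E → ℝ} (hf : ContDiff ℝ 2 f) (p X Y : E) (t : ℝ) :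
    HasDerivAt (fun t : ℝ => f (p + t • X + t ^ 2 • Y))
      (fderiv ℝ f (p + t • X + t ^ 2 • Y) (X + (2 * t) • Y)) t := by
  have h1 : HasDerivAt (fun t : ℝ => p + t • X + t ^ 2 • Y) (X + (2 * t) • Y) t := by
    have h2 := ((hasDerivAt_id t).smul_const X).const_add p
    have h3 := (hasDerivAt_pow 2 t).smul_const Y
    simpa [Pi.add_def] using h2.add h3
  exact ((hf.differentiable (by norm_num)) _).hasFDerivAt.comp_hasDerivAt t h1

/-- The quadratic term `t² Y` lets the second derivative along the curve be shifted by any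
prescribed amount while the velocity at `0` stays `X`. -/
theorem deriv_deriv_comp_parabola {f : E → ℝ} (hf : ContDiff ℝ 2 f) (p X Y : E) :
    deriv (deriv (fun t : ℝ => f (p + t • X + t ^ 2 • Y))) 0 =
      fderiv ℝ (fderiv ℝ f) p X X + 2 * fderiv ℝ f p Y := by
  have h0 : deriv (fun t : ℝ => f (p + t • X + t ^ 2 • Y)) =
      fun t => fderiv ℝ f (p + t • X + t ^ 2 • Y) (X + (2 * t) • Y) :=
    funext fun t => (hasDerivAt_comp_parabola hf p X Y t).deriv
  rw [h0]
  have h1 : HasDerivAt (fun t : ℝ => p + t • X + t ^ 2 • Y) X 0 := by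
    have h2 := ((hasDerivAt_id (0 : ℝ)).smul_const X).const_add p
    have h3 := (hasDerivAt_pow 2 (0 : ℝ)).smul_const Y
    simpa [Pi.add_def] using h2.add h3
  have hd : DifferentiableAt ℝ (fderiv ℝ f) (p + (0 : ℝ) • X + (0 : ℝ) ^ 2 • Y) :=
    ((hf.fderiv_right (m := 1) (by norm_num)).differentiable (by norm_num)) _
  have h4 := hd.hasFDerivAt.comp_hasDerivAt (0 : ℝ) h1
  have h5 : HasDerivAt (fun t : ℝ => X + (2 * t) • Y) ((2 : ℝ) • Y) 0 := by
    simpa using (((hasDerivAt_id (0 : ℝ)).const_mul 2).smul_const Y).const_add X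
  have h6 := (h4.clm_apply h5).deriv
  simp only [Function.comp_def] at h6
  rw [h6]
  simp

theorem fderiv_nonpos_of_nonpos_imp {f g : E → ℝ} {p : E} (hf : DifferentiableAt ℝ f p)
    (hg : DifferentiableAt ℝ g p) (hfp : f p = 0) (hgp : g p = 0) (h : ∀ q, f q ≤ 0 → g q ≤ 0)
    {X : E} (hX : fderiv ℝ f p X < 0) : fderiv ℝ g p X ≤ 0 := by
  by_contra! hc
  have hline : HasDerivAt (fun t : ℝ => p + t • X) X 0 := by
    simpa using ((hasDerivAt_id (0 : ℝ)).smul_const X).const_add p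
  have hF : HasDerivAt (fun t : ℝ => -f (p + t • X)) (-fderiv ℝ f p X) 0 := by
    refine HasDerivAt.neg ?_
    refine HasFDerivAt.comp_hasDerivAt (0 : ℝ) ?_ hline
    simpa using hf.hasFDerivAt
  have hG : HasDerivAt (fun t : ℝ => g (p + t • X)) (fderiv ℝ g p X) 0 := by
    refine HasFDerivAt.comp_hasDerivAt (0 : ℝ) ?_ hline
    simpa using hg.hasFDerivAt
  have h1 := eventually_nhdsWithin_sign_eq_of_deriv_pos
    (f := fun t : ℝ => -f (p + t • X)) (x₀ := 0) (by rw [hF.deriv]; linarith)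
    (by simp [hfp])
  have h2 := eventually_nhdsWithin_sign_eq_of_deriv_pos
    (f := fun t : ℝ => g (p + t • X)) (x₀ := 0) (by rw [hG.deriv]; linarith)
    (by simp [hgp])
  have h3 : ∀ᶠ t : ℝ in nhdsWithin (0 : ℝ) (Set.Ioi 0), False := by
    filter_upwards [h1.filter_mono (nhdsWithin_le_nhds), h2.filter_mono (nhdsWithin_le_nhds),
      self_mem_nhdsWithin] with t h1 h2 ht
    rw [sub_zero, sign_pos (a := t) (Set.mem_Ioi.1 ht), sign_eq_one_iff] at h1 h2
    exact absurd (h _ (by linarith)) (not_le.2 h2)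
  exact h3.exists.elim fun _ h => h

/-- The open half-space where the differential of `f` is negative lies in the closed one where that
of `g` is nonpositive, which forces the two functionals to be positively proportional. -/
theorem exists_fderiv_eq_smul {f g : E → ℝ} {p : E} (hf : DifferentiableAt ℝ f p)
    (hg : DifferentiableAt ℝ g p) (hfp : f p = 0) (hgp : g p = 0) (h : ∀ q, f q ≤ 0 → g q ≤ 0)
    (hf0 : fderiv ℝ f p ≠ 0) (hg0 : fderiv ℝ g p ≠ 0) :
    ∃ c : ℝ, 0 < c ∧ fderiv ℝ g p = c • fderiv ℝ f p := by
  have key := fun X => fderiv_nonpos_of_nonpos_imp hf hg hfp hgp h (X := X)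
  obtain ⟨M, hM⟩ : ∃ M, fderiv ℝ f p M ≠ 0 := by
    by_contra! hc
    exact hf0 (ContinuousLinearMap.ext hc)
  obtain ⟨N, hN⟩ : ∃ N, fderiv ℝ f p N = 1 :=
    ⟨(fderiv ℝ f p M)⁻¹ • M, by simp [hM]⟩
  have hker : ∀ Y, fderiv ℝ f p Y = 0 → fderiv ℝ g p Y ≤ 0 := by
    intro Y hY
    by_contra! hc
    -- A kernel vector is pushed into the open half-space by `-ε N`; the value of `ε` chosen below
    -- makes the bound half of what it bounds.
    have h1 : ∀ ε : ℝ, 0 < ε → fderiv ℝ g p Y ≤ ε * fderiv ℝ g p N := by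
      intro ε hε
      have := key (Y - ε • N) (by simp [hY, hN, hε])
      simp only [map_sub, map_smul, smul_eq_mul] at this
      linarith
    have hpos : 0 < fderiv ℝ g p N := by have := h1 1 one_pos; linarith
    have := h1 (fderiv ℝ g p Y / (2 * fderiv ℝ g p N)) (by positivity)
    field_simp at this
    linarith
  have heq : fderiv ℝ g p = (fderiv ℝ g p N) • fderiv ℝ f p := by
    ext X
    have h1 := hker (X - fderiv ℝ f p X • N) (by simp [hN])
    have h2 := hker (-(X - fderiv ℝ f p X • N)) (by simp [hN])
    simp only [map_sub, map_smul, map_neg, smul_eq_mul, smul_apply] at *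
    linarith
  refine ⟨fderiv ℝ g p N, lt_of_le_of_ne ?_ ?_, heq⟩
  · have := key (-N) (by simp [hN])
    simp only [map_neg] at this
    linarith
  · intro h0
    rw [← h0, zero_smul] at heq
    exact hg0 heq

/-- Bend the line `p + t X` into a parabola on which `f` has negative second derivative at `0`. Then
`f ≤ 0` on it near `0`, hence `g ≤ 0`, so `g` cannot have positive second derivative there. Letting
the bending tend to the critical amount gives the inequality. -/
theorem fderiv_fderiv_le_of_nonpos_imp {f g : E → ℝ} {p : E} (hf : ContDiff ℝ 2 f)
    (hg : ContDiff ℝ 2 g) (hfp : f p = 0) (hgp : g p = 0) (h : ∀ q, f q ≤ 0 → g q ≤ 0)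
    (hf0 : fderiv ℝ f p ≠ 0) {c : ℝ} (hfg : fderiv ℝ g p = c • fderiv ℝ f p)
    {X : E} (hX : fderiv ℝ f p X = 0) :
    fderiv ℝ (fderiv ℝ g) p X X ≤ c * fderiv ℝ (fderiv ℝ f) p X X := by
  obtain ⟨M, hM⟩ : ∃ M, fderiv ℝ f p M ≠ 0 := by
    by_contra! hc
    exact hf0 (ContinuousLinearMap.ext hc)
  have key : ∀ s : ℝ, fderiv ℝ (fderiv ℝ f) p X X + s < 0 →
      fderiv ℝ (fderiv ℝ g) p X X + c * s ≤ 0 := by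
    intro s hs
    set Y : E := (s / (2 * fderiv ℝ f p M)) • M with hY
    have hfY : 2 * fderiv ℝ f p Y = s := by
      simp only [hY, map_smul, smul_eq_mul]; field_simp
    have hgY : 2 * fderiv ℝ g p Y = c * s := by
      rw [hfg, ← hfY, smul_apply, smul_eq_mul]; ring
    have hF2 := deriv_deriv_comp_parabola hf p X Y
    have hG2 := deriv_deriv_comp_parabola hg p X Y
    have hF1 := (hasDerivAt_comp_parabola hf p X Y 0).deriv
    have hG1 := (hasDerivAt_comp_parabola hg p X Y 0).deriv
    rw [hfY] at hF2
    rw [hgY] at hG2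
    rw [← hF2] at hs
    rw [← hG2]
    by_contra! hc
    have hmax := isLocalMax_of_deriv_deriv_neg hs (by simpa [hX] using hF1)
      (hasDerivAt_comp_parabola hf p X Y 0).continuousAt
    have hmin := isLocalMin_of_deriv_deriv_pos hc (by simpa [hfg, hX] using hG1)
      (hasDerivAt_comp_parabola hg p X Y 0).continuousAt
    -- A strict local minimum test for `g` together with `g ≤ 0` makes `g` vanish identically along
    -- the curve, contradicting its positive second derivative.
    have hz : (fun t : ℝ => g (p + t • X + t ^ 2 • Y)) =ᶠ[nhds 0] fun _ => 0 := by
      filter_upwards [hmax, hmin] with t h1 h2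
      simp only [zero_smul, add_zero, ne_eq, OfNat.ofNat_ne_zero, not_false_eq_true, zero_pow,
        hfp, hgp] at h1 h2
      exact le_antisymm (h _ h1) h2
    rw [hz.deriv.deriv_eq] at hc
    simp at hc
  by_contra! hc
  have hcont : ∀ ε : ℝ, 0 < ε → fderiv ℝ (fderiv ℝ g) p X X ≤
      c * fderiv ℝ (fderiv ℝ f) p X X + c * ε := by
    intro ε hε
    have := key (-fderiv ℝ (fderiv ℝ f) p X X - ε) (by linarith)
    linarith
  have h1 := hcont 1 one_pos
  have hcpos : 0 < c := by linarith
  have := hcont ((fderiv ℝ (fderiv ℝ g) p X X - c * fderiv ℝ (fderiv ℝ f) p X X) / (2 * c))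
    (div_pos (by linarith) (by linarith))
  field_simp at this
  linarith

/-- Second-order comparison on the common tangent space of two functions with the same signs. -/
theorem fderiv_fderiv_eq_of_sign {f g : E → ℝ} {p : E} (hf : ContDiff ℝ 2 f)
    (hg : ContDiff ℝ 2 g) (hfp : f p = 0) (hgp : g p = 0) (h : ∀ q, f q ≤ 0 → g q ≤ 0)
    (h' : ∀ q, 0 ≤ f q → 0 ≤ g q)
    (hf0 : fderiv ℝ f p ≠ 0) {c : ℝ} (hfg : fderiv ℝ g p = c • fderiv ℝ f p)
    {X : E} (hX : fderiv ℝ f p X = 0) :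
    fderiv ℝ (fderiv ℝ g) p X X = c * fderiv ℝ (fderiv ℝ f) p X X := by
  refine le_antisymm (fderiv_fderiv_le_of_nonpos_imp hf hg hfp hgp h hf0 hfg hX) ?_
  have hneg : ∀ k : E → ℝ, fderiv ℝ (-k) = -fderiv ℝ k := fun k => funext fun x => fderiv_neg
  have hneg' : fderiv ℝ (fderiv ℝ (-g)) = -fderiv ℝ (fderiv ℝ g) := by
    rw [hneg]; exact funext fun x => fderiv_neg
  have hneg'' : fderiv ℝ (fderiv ℝ (-f)) = -fderiv ℝ (fderiv ℝ f) := by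
    rw [hneg]; exact funext fun x => fderiv_neg
  -- The reverse inequality is the same lemma for `-f` and `-g`, using the other sign condition.
  have := fderiv_fderiv_le_of_nonpos_imp (f := -f) (g := -g) (p := p) hf.neg hg.neg
    (by simp [hfp]) (by simp [hgp]) (fun q hq => by simpa using h' q (by simpa using hq))
    (by simpa [hneg] using hf0) (c := c) (by simp [hneg, hfg]) (X := X) (by simpa [hneg] using hX)
  simp only [hneg', hneg'', neg_apply, Pi.neg_apply] at this
  linarith

end Comparison

/-! ### Chain rule and calculus of the flat function. -/

/-- The Hessian of a composition with a function of one variable. -/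
theorem fderiv_fderiv_comp {E : Type*} [NormedAddCommGroup E] [NormedSpace ℝ E] {r : E → ℝ}
    {g g' : ℝ → ℝ} {g'' : ℝ} {p : E} (hr : ContDiff ℝ 2 r)
    (hg : ∀ᶠ x in nhds (r p), HasDerivAt g (g' x) x) (hg' : HasDerivAt g' g'' (r p)) (v : E) :
    fderiv ℝ (fderiv ℝ (fun q => g (r q))) p v v =
      g' (r p) * fderiv ℝ (fderiv ℝ r) p v v + g'' * fderiv ℝ r p v ^ 2 := by
  have hev : fderiv ℝ (fun q => g (r q)) =ᶠ[nhds p] fun q => g' (r q) • fderiv ℝ r q := by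
    filter_upwards [hr.continuous.continuousAt.eventually hg] with q hq
    exact (hq.comp_hasFDerivAt q (hr.differentiable (by norm_num) q).hasFDerivAt).fderiv
  rw [hev.fderiv_eq]
  have hd : DifferentiableAt ℝ (fderiv ℝ r) p :=
    ((hr.fderiv_right (m := 1) (by norm_num)).differentiable (by norm_num)) _
  have h1 := (hg'.comp_hasFDerivAt p (hr.differentiable (by norm_num) p).hasFDerivAt).smul
    hd.hasFDerivAt
  simp only [Function.comp_def] at h1
  have h2 := h1.fderiv
  erw [h2]
  simp
  ring

theorem expNegInvGlue_hasDerivAt (x : ℝ) :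
    HasDerivAt expNegInvGlue (x⁻¹ ^ 2 * expNegInvGlue x) x := by
  simpa using expNegInvGlue.hasDerivAt_polynomial_eval_inv_mul 1 x

theorem inv_sq_mul_expNegInvGlue_hasDerivAt (x : ℝ) :
    HasDerivAt (fun x => x⁻¹ ^ 2 * expNegInvGlue x)
      ((x⁻¹ ^ 4 - 2 * x⁻¹ ^ 3) * expNegInvGlue x) x := by
  convert expNegInvGlue.hasDerivAt_polynomial_eval_inv_mul (Polynomial.X ^ 2) x using 1
  · simp
  · simp only [Polynomial.derivative_X_pow, Polynomial.eval_mul, Polynomial.eval_sub,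
      Polynomial.eval_pow, Polynomial.eval_X, Polynomial.eval_C]
    norm_num
    left
    ring

theorem one_sub_inv_le_expNegInvGlue {s : ℝ} (hs : 0 < s) : s - 1 ≤ s * expNegInvGlue s := by
  have h1 : expNegInvGlue s = Real.exp (-s⁻¹) := by simp [expNegInvGlue, not_le.2 hs]
  have h2 := Real.add_one_le_exp (-s⁻¹)
  rw [h1]
  calc s - 1 = s * (-s⁻¹ + 1) := by field_simp; ring
    _ ≤ _ := by gcongr

/-! ### Derivatives of the model defining function. -/

/-- The function `a |z - z₀|² + 2 exp (-1 / |w - v₀|²) - b`. -/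
noncomputable def omegaFun (a b : ℝ) (z₀ : ℂ) (v₀ : ℝ) (p : ℂ × ℂ) : ℝ :=
  a * ‖p.1 - z₀‖ ^ 2 + 2 * expNegInvGlue (‖p.2 - (v₀ : ℂ)‖ ^ 2) - b

section OmegaFun

variable (a b : ℝ) (z₀ : ℂ) (v₀ : ℝ)

theorem domainOmega_eq : domainOmega a b z₀ v₀ = {p | omegaFun a b z₀ v₀ p < 0} := by
  ext p
  simp [domainOmega, omegaFun]

theorem omegaFun_contDiff : ContDiff ℝ ∞ (omegaFun a b z₀ v₀) := by
  have h1 : ContDiff ℝ ∞ (fun p : ℂ × ℂ => ‖p.1 - z₀‖ ^ 2) :=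
    (contDiff_fst.sub contDiff_const).norm_sq ℝ
  have h2 : ContDiff ℝ ∞ (fun p : ℂ × ℂ => ‖p.2 - (v₀ : ℂ)‖ ^ 2) :=
    (contDiff_snd.sub contDiff_const).norm_sq ℝ
  exact ((contDiff_const.mul h1).add (contDiff_const.mul (expNegInvGlue.contDiff.comp h2))).sub
    contDiff_const

theorem omegaFun_continuous : Continuous (omegaFun a b z₀ v₀) :=
  (omegaFun_contDiff a b z₀ v₀).continuous

theorem fderiv_omegaFun (p v : ℂ × ℂ) :
    fderiv ℝ (omegaFun a b z₀ v₀) p v = 2 * a * inner ℝ (p.1 - z₀) v.1 +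
      4 * ((‖p.2 - (v₀ : ℂ)‖ ^ 2)⁻¹ ^ 2 * expNegInvGlue (‖p.2 - (v₀ : ℂ)‖ ^ 2)) *
        inner ℝ (p.2 - (v₀ : ℂ)) v.2 := by
  have h1 : HasFDerivAt (fun p : ℂ × ℂ => ‖p.1 - z₀‖ ^ 2) _ p :=
    (hasFDerivAt_fst.sub_const z₀).norm_sq
  have h2 : HasFDerivAt (fun p : ℂ × ℂ => ‖p.2 - (v₀ : ℂ)‖ ^ 2) _ p :=
    (hasFDerivAt_snd.sub_const (v₀ : ℂ)).norm_sq
  have h3 := ((h1.const_mul a).add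
    (((expNegInvGlue_hasDerivAt _).comp_hasFDerivAt p h2).const_mul 2)).sub_const b
  have h4 : HasFDerivAt (omegaFun a b z₀ v₀) _ p := h3
  rw [h4.fderiv]
  simp
  ring

theorem fderiv_fderiv_omegaFun (p v : ℂ × ℂ) :
    fderiv ℝ (fderiv ℝ (omegaFun a b z₀ v₀)) p v v = 2 * a * ‖v.1‖ ^ 2 +
      4 * ((‖p.2 - (v₀ : ℂ)‖ ^ 2)⁻¹ ^ 2 * expNegInvGlue (‖p.2 - (v₀ : ℂ)‖ ^ 2)) * ‖v.2‖ ^ 2 +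
      8 * (((‖p.2 - (v₀ : ℂ)‖ ^ 2)⁻¹ ^ 4 - 2 * (‖p.2 - (v₀ : ℂ)‖ ^ 2)⁻¹ ^ 3) *
        expNegInvGlue (‖p.2 - (v₀ : ℂ)‖ ^ 2)) * inner ℝ (p.2 - (v₀ : ℂ)) v.2 ^ 2 := by
  have hd : DifferentiableAt ℝ (fderiv ℝ (omegaFun a b z₀ v₀)) p :=
    (((omegaFun_contDiff a b z₀ v₀).fderiv_right (m := 1) (by norm_cast)).differentiable
      (by norm_num)) _
  have h0 : HasFDerivAt (fun q => fderiv ℝ (omegaFun a b z₀ v₀) q v)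
      ((fderiv ℝ (fderiv ℝ (omegaFun a b z₀ v₀)) p).flip v) p := by
    simpa using hd.hasFDerivAt.clm_apply (hasFDerivAt_const v p)
  have h2 : HasFDerivAt (fun p : ℂ × ℂ => ‖p.2 - (v₀ : ℂ)‖ ^ 2) _ p :=
    (hasFDerivAt_snd.sub_const (v₀ : ℂ)).norm_sq
  have h3 : HasFDerivAt (fun q : ℂ × ℂ => inner ℝ (q.1 - z₀) v.1) _ p :=
    (hasFDerivAt_fst.sub_const z₀).inner ℝ (hasFDerivAt_const v.1 p)
  have h4 : HasFDerivAt (fun q : ℂ × ℂ => inner ℝ (q.2 - (v₀ : ℂ)) v.2) _ p :=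
    (hasFDerivAt_snd.sub_const (v₀ : ℂ)).inner ℝ (hasFDerivAt_const v.2 p)
  have h5 := (h3.const_mul (2 * a)).add
    ((((inv_sq_mul_expNegInvGlue_hasDerivAt _).comp_hasFDerivAt p h2).const_mul 4).mul h4)
  have h6 := h5.congr_of_eventuallyEq (f₁ := fun q => fderiv ℝ (omegaFun a b z₀ v₀) q v)
    (Filter.Eventually.of_forall fun q => by
      simp only [fderiv_omegaFun, Pi.add_apply, Pi.mul_apply, Function.comp_apply])
  have h7 := congrArg (fun l : ℂ × ℂ →L[ℝ] ℝ => l v) (h0.unique h6)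
  simp only [ContinuousLinearMap.flip_apply] at h7
  rw [h7]
  simp
  ring

end OmegaFun

/-! ### Complex Hessian of the model function and the key estimate. -/

section OmegaHessian

variable (a b : ℝ) (z₀ : ℂ) (v₀ : ℝ)

/-- The coefficient form of `∂r` for the function `r = omegaFun a b z₀ v₀`. -/
noncomputable def omegaForm (p v : ℂ × ℂ) : ℂ :=
  a * star (p.1 - z₀) * v.1 + (2 * ((‖p.2 - (v₀ : ℂ)‖ ^ 2)⁻¹ ^ 2 *
    expNegInvGlue (‖p.2 - (v₀ : ℂ)‖ ^ 2)) : ℝ) * star (p.2 - (v₀ : ℂ)) * v.2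

/-- The complex Hessian of `omegaFun a b z₀ v₀`. -/
noncomputable def omegaHess (p v : ℂ × ℂ) : ℝ :=
  a * ‖v.1‖ ^ 2 + 2 * (((‖p.2 - (v₀ : ℂ)‖ ^ 2)⁻¹ ^ 3 - (‖p.2 - (v₀ : ℂ)‖ ^ 2)⁻¹ ^ 2) *
    expNegInvGlue (‖p.2 - (v₀ : ℂ)‖ ^ 2)) * ‖v.2‖ ^ 2

/-- The two inner products are, up to sign, the real and imaginary parts of `conj x * y`. -/
theorem inner_sq_add_inner_I_mul_sq (x y : ℂ) :
    inner ℝ x y ^ 2 + inner ℝ x (Complex.I * y) ^ 2 = ‖x‖ ^ 2 * ‖y‖ ^ 2 := by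
  simp only [Complex.inner, Complex.sq_norm, Complex.normSq_apply, Complex.mul_re, Complex.mul_im,
    Complex.conj_re, Complex.conj_im, Complex.I_re, Complex.I_im]
  ring

theorem fderiv_omegaFun_eq_re (p v : ℂ × ℂ) :
    fderiv ℝ (omegaFun a b z₀ v₀) p v = 2 * (omegaForm a z₀ v₀ p v).re := by
  rw [fderiv_omegaFun, omegaForm]
  generalize (‖p.2 - (v₀ : ℂ)‖ ^ 2)⁻¹ ^ 2 * expNegInvGlue (‖p.2 - (v₀ : ℂ)‖ ^ 2) = g
  simp [Complex.inner]
  ring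

theorem fderiv_omegaFun_I_smul (p v : ℂ × ℂ) :
    fderiv ℝ (omegaFun a b z₀ v₀) p (Complex.I • v) = -2 * (omegaForm a z₀ v₀ p v).im := by
  rw [fderiv_omegaFun, omegaForm]
  generalize (‖p.2 - (v₀ : ℂ)‖ ^ 2)⁻¹ ^ 2 * expNegInvGlue (‖p.2 - (v₀ : ℂ)‖ ^ 2) = g
  simp [Complex.inner]
  ring

theorem fderiv_fderiv_omegaFun_add (p v : ℂ × ℂ) :
    fderiv ℝ (fderiv ℝ (omegaFun a b z₀ v₀)) p v v +
      fderiv ℝ (fderiv ℝ (omegaFun a b z₀ v₀)) p (Complex.I • v) (Complex.I • v) =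
      4 * omegaHess a v₀ p v := by
  rw [fderiv_fderiv_omegaFun, fderiv_fderiv_omegaFun, omegaHess]
  have h := inner_sq_add_inner_I_mul_sq (p.2 - (v₀ : ℂ)) v.2
  simp only [Prod.smul_fst, Prod.smul_snd, smul_eq_mul, norm_mul, Complex.norm_I, one_mul]
  generalize ‖p.2 - (v₀ : ℂ)‖ ^ 2 = s at *
  -- The convention `0⁻¹ = 0` keeps the identity valid at `s = 0`.
  have h2 : (s⁻¹ ^ 4 - 2 * s⁻¹ ^ 3) * s = s⁻¹ ^ 3 - 2 * s⁻¹ ^ 2 := by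
    rcases eq_or_ne s 0 with rfl | hs
    · simp
    · field_simp
  linear_combination (8 * (s⁻¹ ^ 4 - 2 * s⁻¹ ^ 3) * expNegInvGlue s) * h +
    8 * ‖v.2‖ ^ 2 * expNegInvGlue s * h2

theorem complexHessian_omegaFun (p v : ℂ × ℂ) :
    complexHessian (omegaFun a b z₀ v₀) p v v = (omegaHess a v₀ p v : ℂ) := by
  rw [complexHessian_self ((omegaFun_contDiff a b z₀ v₀).of_le (by norm_cast)).contDiffAt,
    fderiv_fderiv_omegaFun_add]
  congr 1
  ring

theorem isHolTangent_omegaFun_iff (p v : ℂ × ℂ) :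
    IsHolTangent (omegaFun a b z₀ v₀) p v ↔ omegaForm a z₀ v₀ p v = 0 := by
  rw [isHolTangent_iff ((omegaFun_contDiff a b z₀ v₀).differentiable (by simp) p),
    fderiv_omegaFun_eq_re, fderiv_omegaFun_I_smul, Complex.ext_iff]
  simp

variable {a b} {z₀ v₀}

/-- Positivity of the Hessian of `exp (r / (2 - b))` on the closure of the domain. -/
theorem omegaHess_add_nonneg (ha : 0 < a) (hb₂ : b < 2) {p : ℂ × ℂ}
    (hp : omegaFun a b z₀ v₀ p ≤ 0) (v : ℂ × ℂ) :
    0 ≤ omegaHess a v₀ p v + (2 - b)⁻¹ * ‖omegaForm a z₀ v₀ p v‖ ^ 2 := by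
  have hK : 0 < 2 - b := by linarith
  have hφ0 := expNegInvGlue.nonneg (‖p.2 - (v₀ : ℂ)‖ ^ 2)
  by_cases hs : ‖p.2 - (v₀ : ℂ)‖ ^ 2 ≤ 1
  · have hβ : 0 ≤ (‖p.2 - (v₀ : ℂ)‖ ^ 2)⁻¹ ^ 3 - (‖p.2 - (v₀ : ℂ)‖ ^ 2)⁻¹ ^ 2 := by
      rcases (sq_nonneg ‖p.2 - (v₀ : ℂ)‖).eq_or_lt with h0 | h0
      · simp [← h0]
      · have := (one_le_inv₀ h0).2 hs
        have h2 := sq_nonneg (‖p.2 - (v₀ : ℂ)‖ ^ 2)⁻¹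
        nlinarith
    have := mul_nonneg hβ hφ0
    unfold omegaHess
    positivity
  · push Not at hs
    have hs0 : 0 < ‖p.2 - (v₀ : ℂ)‖ ^ 2 := by linarith
    have hφ := one_sub_inv_le_expNegInvGlue hs0
    -- For `s > 1` the Hessian is negative in `w`, and this is absorbed by the `w`-part of `∂r`,
    -- which is bounded by `∂r` and its `z`-part.
    have htri : 2 * ((‖p.2 - (v₀ : ℂ)‖ ^ 2)⁻¹ ^ 2 * expNegInvGlue (‖p.2 - (v₀ : ℂ)‖ ^ 2)) *
        ‖p.2 - (v₀ : ℂ)‖ * ‖v.2‖ ≤ a * ‖p.1 - z₀‖ * ‖v.1‖ + ‖omegaForm a z₀ v₀ p v‖ := by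
      have h1 := norm_sub_le (omegaForm a z₀ v₀ p v) (a * star (p.1 - z₀) * v.1)
      have h2 : omegaForm a z₀ v₀ p v - a * star (p.1 - z₀) * v.1 =
        (2 * ((‖p.2 - (v₀ : ℂ)‖ ^ 2)⁻¹ ^ 2 * expNegInvGlue (‖p.2 - (v₀ : ℂ)‖ ^ 2)) : ℝ) *
          star (p.2 - (v₀ : ℂ)) * v.2 := by rw [omegaForm]; ring
      rw [h2, norm_mul, norm_mul, norm_mul, norm_mul, norm_star, norm_star, Complex.norm_real,
        Complex.norm_real, Real.norm_of_nonneg (by positivity), Real.norm_of_nonneg ha.le] at h1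
      linarith
    rw [omegaHess]
    unfold omegaFun at hp
    have hn1 : 0 ≤ 2 * ((‖p.2 - (v₀ : ℂ)‖ ^ 2)⁻¹ ^ 2 *
        expNegInvGlue (‖p.2 - (v₀ : ℂ)‖ ^ 2)) * ‖p.2 - (v₀ : ℂ)‖ * ‖v.2‖ := by positivity
    have hsq := pow_le_pow_left₀ hn1 htri 2
    have hm : 0 ≤ a * ‖p.1 - z₀‖ ^ 2 := by positivity
    rw [mul_pow, mul_pow, mul_pow] at hsq
    generalize ‖p.2 - (v₀ : ℂ)‖ ^ 2 = s at *
    generalize expNegInvGlue s = φ at *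
    generalize ‖omegaForm a z₀ v₀ p v‖ = N at *
    generalize ‖p.1 - z₀‖ = m at *
    generalize ‖v.1‖ = x at *
    generalize ‖v.2‖ = y at *
    -- Cauchy–Schwarz with weights chosen so that, by `r ≤ 0`, the first factor is at most `2 - 2
    -- φ`; this is where the constant `2 - b` comes from.
    have hcs : (a * m * x + N) ^ 2 ≤ (a * m ^ 2 + (2 - b)) * (a * x ^ 2 + (2 - b)⁻¹ * N ^ 2) := by
      have : (a * m ^ 2 + (2 - b)) * (a * x ^ 2 + (2 - b)⁻¹ * N ^ 2) - (a * m * x + N) ^ 2 =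
        a * (2 - b)⁻¹ * (m * N - (2 - b) * x) ^ 2 := by
        field_simp
        ring
      have h3 : 0 ≤ a * (2 - b)⁻¹ * (m * N - (2 - b) * x) ^ 2 := by positivity
      linarith
    have hle : (a * m ^ 2 + (2 - b)) * (a * x ^ 2 + (2 - b)⁻¹ * N ^ 2) ≤
        (2 - 2 * φ) * (a * x ^ 2 + (2 - b)⁻¹ * N ^ 2) := by
      gcongr
      linarith
    -- After clearing factors this is exactly `s - 1 ≤ s φ`.
    have hβ : (2 - 2 * φ) * (2 * ((s⁻¹ ^ 2 - s⁻¹ ^ 3) * φ)) ≤ 2 ^ 2 * (s⁻¹ ^ 2 * φ) ^ 2 * s := by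
      have : 2 ^ 2 * (s⁻¹ ^ 2 * φ) ^ 2 * s - (2 - 2 * φ) * (2 * ((s⁻¹ ^ 2 - s⁻¹ ^ 3) * φ)) =
        4 * φ * s⁻¹ ^ 3 * (φ * s - (s - 1)) := by
        field_simp
        ring
      have h4 : 0 ≤ 4 * φ * s⁻¹ ^ 3 * (φ * s - (s - 1)) :=
        mul_nonneg (by positivity) (by linarith)
      linarith
    have hβ' := mul_le_mul_of_nonneg_right hβ (sq_nonneg y)
    have hpos : 0 < 2 - 2 * φ := by linarith
    refine le_of_mul_le_mul_left ?_ hpos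
    linarith

/-- Strict positivity of the Levi form in some tangent direction away from `w = v₀`. -/
theorem exists_omegaForm_eq_zero_omegaHess_pos (ha : 0 < a) (hb₀ : 0 < b) (hb₂ : b < 2)
    {p : ℂ × ℂ} (hp : omegaFun a b z₀ v₀ p = 0) (hw : p.2 ≠ v₀) :
    ∃ v, omegaForm a z₀ v₀ p v = 0 ∧ 0 < omegaHess a v₀ p v := by
  -- The vector `(-r_w, r_z)`, which `∂r` annihilates.
  refine ⟨(-((2 * ((‖p.2 - (v₀ : ℂ)‖ ^ 2)⁻¹ ^ 2 *
    expNegInvGlue (‖p.2 - (v₀ : ℂ)‖ ^ 2)) : ℝ) * star (p.2 - (v₀ : ℂ))),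
    a * star (p.1 - z₀)), by rw [omegaForm]; ring, ?_⟩
  have hs0 : 0 < ‖p.2 - (v₀ : ℂ)‖ ^ 2 := by
    have := norm_pos_iff.2 (sub_ne_zero.2 hw)
    positivity
  have hφ0 := expNegInvGlue.pos_of_pos hs0
  have hφ := one_sub_inv_le_expNegInvGlue hs0
  simp only [omegaHess, norm_neg, norm_mul, norm_star, Complex.norm_real, mul_pow,
    Real.norm_eq_abs, sq_abs]
  unfold omegaFun at hp
  generalize ‖p.2 - (v₀ : ℂ)‖ ^ 2 = s at *
  generalize expNegInvGlue s = φ at *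
  generalize ‖p.1 - z₀‖ = m at *
  have h1 : a * m ^ 2 = b - 2 * φ := by linarith
  have h2 : a * (2 ^ 2 * ((s⁻¹ ^ 2) ^ 2 * φ ^ 2) * s) + 2 * ((s⁻¹ ^ 3 - s⁻¹ ^ 2) * φ) *
      (a ^ 2 * m ^ 2) = 2 * a * φ * s⁻¹ ^ 3 * (b * (1 - s) + 2 * (s * φ)) := by
    have : a ^ 2 * m ^ 2 = a * (b - 2 * φ) := by rw [← h1]; ring
    rw [this]
    field_simp
    ring
  rw [h2]
  -- For `s > 1`, `b (s - 1) < 2 (s - 1) ≤ 2 s φ`; this uses `b < 2`.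
  have h3 : 0 < b * (1 - s) + 2 * (s * φ) := by
    have h4 : 0 < s * φ := by positivity
    rcases le_or_gt s 1 with h | h
    · nlinarith
    · nlinarith
  positivity

end OmegaHessian

/-! ### Defining functions and plurisubharmonicity of powers. -/

/-- A smooth function with nonzero differential on its zero set is a defining function. -/
theorem isDefiningFunction_of_contDiff {f : ℂ × ℂ → ℝ} (hf : ContDiff ℝ ∞ f)
    (h0 : ∀ p, f p = 0 → fderiv ℝ f p ≠ 0) : IsDefiningFunction {p | f p < 0} f := by
  have hfr : frontier {p | f p < 0} = {p | f p = 0} := by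
    refine Set.Subset.antisymm (frontier_lt_subset_eq hf.continuous continuous_const) ?_
    intro p hp
    rw [(isOpen_lt hf.continuous continuous_const).frontier_eq]
    refine ⟨?_, by simp [show f p = 0 from hp]⟩
    by_contra hc
    -- A zero outside the closure of `{f < 0}` would be a local minimum, hence a critical point.
    refine h0 p hp (IsLocalMin.fderiv_eq_zero ?_)
    filter_upwards [isClosed_closure.isOpen_compl.mem_nhds hc] with q hq
    rw [show f p = 0 from hp]
    by_contra! hlt
    exact hq (subset_closure hlt)
  exact ⟨hf, rfl, hfr, fun p hp => h0 p (by rw [hfr] at hp; exact hp)⟩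

/-- Tangent spaces agree and Levi forms are positively proportional for two defining functions. -/
theorem IsDefiningFunction.exists_complexHessian_eq {Ω : Set (ℂ × ℂ)} {f g : ℂ × ℂ → ℝ}
    (hf : IsDefiningFunction Ω f) (hg : IsDefiningFunction Ω g) {p : ℂ × ℂ}
    (hp : p ∈ frontier Ω) :
    ∃ c : ℝ, 0 < c ∧ ∀ v, (IsHolTangent g p v ↔ IsHolTangent f p v) ∧
      (IsHolTangent f p v → complexHessian g p v v = c * complexHessian f p v v) := by
  have hneg : ∀ q, f q < 0 ↔ g q < 0 := fun q => by
    have := hf.eq_neg.symm.trans hg.eq_neg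
    exact Set.ext_iff.1 this q
  have hzero : ∀ q, f q = 0 ↔ g q = 0 := fun q => by
    have := hf.frontier_eq.symm.trans hg.frontier_eq
    exact Set.ext_iff.1 this q
  have hfp : f p = 0 := by rw [hf.frontier_eq] at hp; exact hp
  have hgp : g p = 0 := (hzero p).1 hfp
  have h1 : ∀ q, f q ≤ 0 → g q ≤ 0 := fun q hq => by
    rcases hq.lt_or_eq with h | h
    · exact ((hneg q).1 h).le
    · exact ((hzero q).1 h).le
  have h2 : ∀ q, 0 ≤ f q → 0 ≤ g q := fun q hq => by
    rw [← not_lt] at hq ⊢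
    rwa [← hneg]
  have hf2 : ContDiff ℝ 2 f := hf.smooth.of_le (by norm_cast)
  have hg2 : ContDiff ℝ 2 g := hg.smooth.of_le (by norm_cast)
  have hfd := hf2.differentiable (by norm_num) p
  have hgd := hg2.differentiable (by norm_num) p
  obtain ⟨c, hc, hcfg⟩ := exists_fderiv_eq_smul hfd hgd hfp hgp h1
    (hf.fderiv_ne_zero p hp) (hg.fderiv_ne_zero p hp)
  refine ⟨c, hc, fun v => ⟨?_, fun hv => ?_⟩⟩
  · simp [isHolTangent_iff hfd, isHolTangent_iff hgd, hcfg, hc.ne']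
  · rw [isHolTangent_iff hfd] at hv
    -- Holomorphic tangency puts both `v` and `i v` in the real tangent space, so the comparison
    -- applies to each real Hessian term.
    have key := fun {X} => fderiv_fderiv_eq_of_sign hf2 hg2 hfp hgp h1 h2
      (hf.fderiv_ne_zero p hp) hcfg (X := X)
    rw [complexHessian_self hf2.contDiffAt, complexHessian_self hg2.contDiffAt, key hv.1,
      key hv.2]
    push_cast
    ring

theorem IsDefiningFunction.exp_sub_one {Ω : Set (ℂ × ℂ)} {f : ℂ × ℂ → ℝ}
    (hf : IsDefiningFunction Ω f) {K : ℝ} (hK : 0 < K) :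
    IsDefiningFunction Ω (fun p => Real.exp (K * f p) - 1) := by
  refine ⟨(Real.contDiff_exp.comp (contDiff_const.mul hf.smooth)).sub contDiff_const, ?_, ?_, ?_⟩
  · rw [hf.eq_neg]
    ext p
    simp only [Set.mem_ofPred_eq, sub_neg, Real.exp_lt_one_iff, mul_neg_iff]
    constructor
    · exact fun h => Or.inl ⟨hK, h⟩
    · rintro (h | h)
      · exact h.2
      · linarith [h.1]
  · rw [hf.frontier_eq]
    ext p
    simp [sub_eq_zero, hK.ne']
  · intro p hp
    have h1 : HasFDerivAt (fun p => Real.exp (K * f p) - 1) _ p :=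
      (((hf.smooth.differentiable (by simp) p).hasFDerivAt.const_mul K).exp).sub_const 1
    rw [h1.fderiv]
    exact smul_ne_zero (Real.exp_pos _).ne' (smul_ne_zero hK.ne' (hf.fderiv_ne_zero p hp))

/-- A sufficient condition for `-(1 - exp (K f)) ^ τ` to be plurisubharmonic on `{f < 0}`. -/
theorem isPlurisubharmonicOn_neg_rpow {f : ℂ × ℂ → ℝ} (hf : ContDiff ℝ 2 f) {K τ : ℝ}
    (hK : 0 < K) (hτ₀ : 0 < τ) (hτ₁ : τ ≤ 1)
    (hH : ∀ p, f p < 0 → ∀ v, 0 ≤ fderiv ℝ (fderiv ℝ f) p v v +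
      fderiv ℝ (fderiv ℝ f) p (Complex.I • v) (Complex.I • v) +
      K * (fderiv ℝ f p v ^ 2 + fderiv ℝ f p (Complex.I • v) ^ 2)) :
    IsPlurisubharmonicOn (fun p => -(-(Real.exp (K * f p) - 1)) ^ τ) {p | f p < 0} := by
  have hpos : ∀ x : ℝ, x < 0 → 0 < -(Real.exp (K * x) - 1) := fun x hx => by
    have := Real.exp_lt_one_iff.2 (mul_neg_of_pos_of_neg hK hx)
    linarith
  have hC : ∀ p, f p < 0 → ContDiffAt ℝ 2 (fun p => -(-(Real.exp (K * f p) - 1)) ^ τ) p := by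
    intro p hp
    have h1 : ContDiff ℝ 2 (fun p => -(Real.exp (K * f p) - 1)) :=
      ((Real.contDiff_exp.comp (contDiff_const.mul hf)).sub contDiff_const).neg
    exact (h1.contDiffAt.rpow_const_of_ne (hpos _ hp).ne').neg
  refine ⟨fun p hp => (hC p hp).contDiffWithinAt, fun p hp v => ?_⟩
  have hp' : f p < 0 := hp
  rw [complexHessian_self (hC p hp), Complex.ofReal_re]
  have hexp : ∀ x : ℝ, HasDerivAt (fun x => Real.exp (K * x)) (K * Real.exp (K * x)) x := by
    intro x
    simpa [mul_comm] using ((hasDerivAt_id x).const_mul K).exp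
  have hbase : ∀ x : ℝ, HasDerivAt (fun x => -(Real.exp (K * x) - 1)) (-(K * Real.exp (K * x))) x :=
    fun x => ((hexp x).sub_const 1).neg
  have hg : ∀ x : ℝ, x < 0 → HasDerivAt (fun x => -(-(Real.exp (K * x) - 1)) ^ τ)
      (τ * (-(Real.exp (K * x) - 1)) ^ (τ - 1) * (K * Real.exp (K * x))) x := by
    intro x hx
    refine HasDerivAt.congr_deriv
      ((hbase x).rpow_const (p := τ) (Or.inl (hpos x hx).ne')).neg ?_
    ring
  -- For `g x = -(1 - exp (K x)) ^ τ` this writes `g''` as `K g'` plus a term that is nonnegative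
  -- because `τ ≤ 1`; the `K g'` part is what `hH` pairs with the Hessian of `f`.
  have hg' : HasDerivAt
      (fun x => τ * (-(Real.exp (K * x) - 1)) ^ (τ - 1) * (K * Real.exp (K * x)))
      (τ * (1 - τ) * (-(Real.exp (K * f p) - 1)) ^ (τ - 1 - 1) * (K * Real.exp (K * f p)) ^ 2 +
        K * (τ * (-(Real.exp (K * f p) - 1)) ^ (τ - 1) * (K * Real.exp (K * f p)))) (f p) := by
    refine HasDerivAt.congr_deriv
      ((((hbase (f p)).rpow_const (p := τ - 1) (Or.inl (hpos _ hp').ne')).const_mul τ).mul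
        ((hexp (f p)).const_mul K)) ?_
    ring
  have key := fun u => fderiv_fderiv_comp hf
    (Filter.eventually_of_mem (Iio_mem_nhds hp') hg) hg' u
  simp only [key]
  have h1 : 0 ≤ τ * (-(Real.exp (K * f p) - 1)) ^ (τ - 1) * (K * Real.exp (K * f p)) := by
    have := hpos _ hp'
    positivity
  have h2 : 0 ≤ τ * (1 - τ) * (-(Real.exp (K * f p) - 1)) ^ (τ - 1 - 1) *
      (K * Real.exp (K * f p)) ^ 2 := by
    have := hpos _ hp'
    have : 0 ≤ 1 - τ := by linarith
    positivity
  have h3 := mul_nonneg h1 (hH p hp' v)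
  have h4 := mul_nonneg h2 (add_nonneg (sq_nonneg (fderiv ℝ f p v))
    (sq_nonneg (fderiv ℝ f p (Complex.I • v))))
  linarith

/-! ### The domain: geometry, Levi-flat circle and index. -/

section OmegaDomain

variable {a b : ℝ} {z₀ : ℂ} {v₀ : ℝ}

theorem isDefiningFunction_omegaFun (ha : 0 < a) (hb₀ : 0 < b) :
    IsDefiningFunction (domainOmega a b z₀ v₀) (omegaFun a b z₀ v₀) := by
  rw [domainOmega_eq]
  refine isDefiningFunction_of_contDiff (omegaFun_contDiff a b z₀ v₀) fun p hp h0 => ?_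
  -- Testing a critical point on the two radial directions gives `z = z₀` and `φ = 0`, hence `r =
  -- -b`, which is not `0`.
  have h1 := fderiv_omegaFun a b z₀ v₀ p (p.1 - z₀, 0)
  have h2 := fderiv_omegaFun a b z₀ v₀ p (0, p.2 - (v₀ : ℂ))
  simp only [h0, zero_apply, real_inner_self_eq_norm_sq, inner_zero_right, mul_zero, add_zero,
    zero_add] at h1 h2
  have h3 : ‖p.1 - z₀‖ ^ 2 = 0 := by
    rcases mul_eq_zero.1 h1.symm with h | h
    · linarith
    · exact h
  have h4 : expNegInvGlue (‖p.2 - (v₀ : ℂ)‖ ^ 2) = 0 := by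
    generalize ‖p.2 - (v₀ : ℂ)‖ ^ 2 = s at *
    rcases eq_or_ne s 0 with rfl | hs
    · simp
    · simpa [hs] using h2.symm
  rw [omegaFun, h3, h4] at hp
  linarith

theorem isBoundedSmoothDomain_domainOmega (ha : 0 < a) (hb₀ : 0 < b) (hb₂ : b < 2) :
    IsBoundedSmoothDomain (domainOmega a b z₀ v₀) := by
  refine ⟨?_, ?_, ?_, _, isDefiningFunction_omegaFun ha hb₀⟩
  · rw [domainOmega_eq]
    exact isOpen_lt (omegaFun_continuous a b z₀ v₀) continuous_const
  -- Both terms increase with the distance from the centre, so the domain is star-shaped.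
  · have hstar : StarConvex ℝ (z₀, (v₀ : ℂ)) (domainOmega a b z₀ v₀) := by
      rw [starConvex_iff_forall_pos (by simpa [domainOmega] using hb₀)]
      intro p hp s t hs ht hst
      have e1 : s • z₀ + t • p.1 - z₀ = t • (p.1 - z₀) := by
        rw [← eq_sub_iff_add_eq'] at hst
        rw [hst]; module
      have e2 : s • (v₀ : ℂ) + t • p.2 - (v₀ : ℂ) = t • (p.2 - (v₀ : ℂ)) := by
        rw [← eq_sub_iff_add_eq'] at hst
        rw [hst]; module
      have ht1 : t ^ 2 ≤ 1 := by nlinarith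
      simp only [domainOmega, Set.mem_ofPred_eq, Prod.fst_add, Prod.snd_add, Prod.smul_fst,
        Prod.smul_snd, e1, e2, norm_smul, mul_pow, Real.norm_eq_abs, sq_abs] at hp ⊢
      have h1 : t ^ 2 * ‖p.1 - z₀‖ ^ 2 ≤ ‖p.1 - z₀‖ ^ 2 :=
        mul_le_of_le_one_left (sq_nonneg _) ht1
      have h2 := expNegInvGlue.monotone (show t ^ 2 * ‖p.2 - (v₀ : ℂ)‖ ^ 2 ≤ ‖p.2 - (v₀ : ℂ)‖ ^ 2 from
        mul_le_of_le_one_left (sq_nonneg _) ht1)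
      have h3 := mul_le_mul_of_nonneg_left h1 ha.le
      linarith
    exact (hstar.isPathConnected (by simpa [domainOmega] using hb₀)).isConnected
  · have hsub : domainOmega a b z₀ v₀ ⊆ Metric.closedBall z₀ (b / a + 1) ×ˢ
        Metric.closedBall (v₀ : ℂ) (2 / (2 - b) + 1) := by
      intro p hp
      simp only [domainOmega, Set.mem_ofPred_eq] at hp
      have hφ0 := expNegInvGlue.nonneg (‖p.2 - (v₀ : ℂ)‖ ^ 2)
      have hm : 0 ≤ a * ‖p.1 - z₀‖ ^ 2 := by positivity
      refine ⟨?_, ?_⟩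
      · rw [Metric.mem_closedBall, dist_eq_norm]
        have h1 : ‖p.1 - z₀‖ ^ 2 ≤ b / a := by
          rw [le_div_iff₀ ha]
          linarith
        nlinarith [sq_nonneg (‖p.1 - z₀‖ - 1)]
      · rw [Metric.mem_closedBall, dist_eq_norm]
        have hK : 0 < 2 - b := by linarith
        -- From `2 (s - 1) ≤ 2 s φ` and `2 φ < b` follows `s (2 - b) ≤ 2`.
        have h1 : ‖p.2 - (v₀ : ℂ)‖ ^ 2 ≤ 2 / (2 - b) := by
          rcases (sq_nonneg ‖p.2 - (v₀ : ℂ)‖).eq_or_lt with h0 | h0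
          · rw [← h0]; positivity
          · have := one_sub_inv_le_expNegInvGlue h0
            rw [le_div_iff₀ hK]
            nlinarith
        nlinarith [sq_nonneg (‖p.2 - (v₀ : ℂ)‖ - 1)]
    exact (Metric.isBounded_closedBall.prod Metric.isBounded_closedBall).subset hsub

theorem omegaHess_nonneg (ha : 0 < a) (hb₂ : b < 2) {p v : ℂ × ℂ}
    (hp : omegaFun a b z₀ v₀ p = 0) (hv : omegaForm a z₀ v₀ p v = 0) :
    0 ≤ omegaHess a v₀ p v := by
  simpa [hv] using omegaHess_add_nonneg ha hb₂ hp.le v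

theorem isLeviPseudoconvex_domainOmega (ha : 0 < a) (hb₀ : 0 < b) (hb₂ : b < 2) {ρ : ℂ × ℂ → ℝ}
    (hρ : IsDefiningFunction (domainOmega a b z₀ v₀) ρ) :
    IsLeviPseudoconvex (domainOmega a b z₀ v₀) ρ := by
  have hr := isDefiningFunction_omegaFun (z₀ := z₀) (v₀ := v₀) ha hb₀
  intro p hp v hv
  obtain ⟨c, hc, h⟩ := hr.exists_complexHessian_eq hρ hp
  have hv' := (h v).1.1 hv
  rw [(h v).2 hv', complexHessian_omegaFun, Complex.re_ofReal_mul, Complex.ofReal_re]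
  rw [hr.frontier_eq] at hp
  exact mul_nonneg hc.le (omegaHess_nonneg ha hb₂ hp
    ((isHolTangent_omegaFun_iff a b z₀ v₀ p v).1 hv'))

theorem mem_circle_iff (ha : 0 < a) (hb₀ : 0 < b) (p : ℂ × ℂ) :
    (‖p.1 - z₀‖ = Real.sqrt (b / a) ∧ p.2 = (v₀ : ℂ)) ↔
      omegaFun a b z₀ v₀ p = 0 ∧ p.2 = v₀ := by
  refine and_congr_left fun h => ?_
  have h1 : 0 < b / a := by positivity
  rw [omegaFun, h, eq_comm, Real.sqrt_eq_iff_eq_sq h1.le (norm_nonneg _), div_eq_iff ha.ne']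
  simp only [sub_self, norm_zero, ne_eq, OfNat.ofNat_ne_zero, not_false_eq_true, zero_pow,
    expNegInvGlue.zero, mul_zero, add_zero]
  constructor <;> intro h <;> linarith

theorem leviFlatSet_domainOmega (ha : 0 < a) (hb₀ : 0 < b) (hb₂ : b < 2) {ρ : ℂ × ℂ → ℝ}
    (hρ : IsDefiningFunction (domainOmega a b z₀ v₀) ρ) :
    leviFlatSet (domainOmega a b z₀ v₀) ρ =
      {p : ℂ × ℂ | ‖p.1 - z₀‖ = Real.sqrt (b / a) ∧ p.2 = (v₀ : ℂ)} := by
  have hr := isDefiningFunction_omegaFun (z₀ := z₀) (v₀ := v₀) ha hb₀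
  ext p
  rw [Set.mem_ofPred_eq, mem_circle_iff ha hb₀]
  constructor
  · rintro ⟨hp, hL⟩
    obtain ⟨c, hc, h⟩ := hr.exists_complexHessian_eq hρ hp
    rw [hr.frontier_eq] at hp
    refine ⟨hp, ?_⟩
    by_contra hw
    obtain ⟨v, hv, hpos⟩ := exists_omegaForm_eq_zero_omegaHess_pos ha hb₀ hb₂ hp hw
    have hv' := (isHolTangent_omegaFun_iff a b z₀ v₀ p v).2 hv
    have := hL v ((h v).1.2 hv')
    rw [(h v).2 hv', complexHessian_omegaFun, ← Complex.ofReal_mul, Complex.ofReal_eq_zero] at this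
    exact (mul_pos hc hpos).ne' this
  · rintro ⟨hp, hw⟩
    have hp' : p ∈ frontier (domainOmega a b z₀ v₀) := by rw [hr.frontier_eq]; exact hp
    refine ⟨hp', fun v hv => ?_⟩
    obtain ⟨c, hc, h⟩ := hr.exists_complexHessian_eq hρ hp'
    have hv' := (h v).1.1 hv
    rw [(h v).2 hv', complexHessian_omegaFun]
    have h1 := (isHolTangent_omegaFun_iff a b z₀ v₀ p v).1 hv'
    -- At `w = v₀` only the `dz` term of `∂r` survives, with nonzero coefficient, so tangent vectors
    -- point in the `w` direction.
    have hz : p.1 - z₀ ≠ 0 := by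
      intro h0
      simp [omegaFun, h0, hw] at hp
      exact hb₀.ne' hp
    have h2 : v.1 = 0 := by
      have h3 : (starRingEnd ℂ) p.1 - (starRingEnd ℂ) z₀ ≠ 0 := by
        rwa [← map_sub, ne_eq, map_eq_zero]
      simpa [omegaForm, hw, ha.ne', h3] using h1
    simp [omegaHess, hw, h2]

theorem exists_isSimpleClosedParam_circle (ha : 0 < a) (hb₀ : 0 < b) {ρ : ℂ × ℂ → ℝ}
    (hρ : IsDefiningFunction (domainOmega a b z₀ v₀) ρ) :
    ∃ (γ : ℝ → ℂ × ℂ) (T : ℝ),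
      IsSimpleClosedParam γ T
        {p : ℂ × ℂ | ‖p.1 - z₀‖ = Real.sqrt (b / a) ∧ p.2 = (v₀ : ℂ)} ∧
      ∀ (t : ℝ) (L : ℂ × ℂ), L ≠ 0 → IsHolTangent ρ (γ t) L → IsTransversal (deriv γ t) L := by
  have hr := isDefiningFunction_omegaFun (z₀ := z₀) (v₀ := v₀) ha hb₀
  have hR : 0 < Real.sqrt (b / a) := Real.sqrt_pos.2 (by positivity)
  set R := Real.sqrt (b / a) with hRdef
  have hderiv : ∀ t : ℝ, HasDerivAt (fun t : ℝ => (circleMap z₀ R t, (v₀ : ℂ)))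
      (circleMap 0 R t * Complex.I, 0) t := fun t =>
    (hasDerivAt_circleMap z₀ R t).prodMk (hasDerivAt_const t _)
  have hne : ∀ t, circleMap 0 R t * Complex.I ≠ 0 := fun t => by
    simp [circleMap, hR.ne']
  refine ⟨fun t => (circleMap z₀ R t, (v₀ : ℂ)), 2 * Real.pi, ⟨?_, ?_, Real.two_pi_pos, ?_, ?_, ?_⟩,
    ?_⟩
  · exact (contDiff_circleMap z₀ R).prodMk contDiff_const
  · intro t
    rw [(hderiv t).deriv]
    exact fun h => hne t (congrArg Prod.fst h)
  · intro t
    simp only [periodic_circleMap z₀ R t]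
  · intro s hs t ht hst
    exact injOn_circleMap_of_abs_sub_le' hR.ne' (by simp) hs ht
      (congrArg Prod.fst hst)
  · ext p
    simp only [Set.mem_range, Set.mem_ofPred_eq]
    constructor
    · rintro ⟨t, rfl⟩
      simp [circleMap, abs_of_pos hR]
    · rintro ⟨h1, h2⟩
      have : p.1 ∈ Set.range (circleMap z₀ R) := by
        rw [range_circleMap, abs_of_pos hR, mem_sphere_iff_norm]
        exact h1
      obtain ⟨t, ht⟩ := this
      exact ⟨t, Prod.ext ht h2.symm⟩
  · intro t L hL hT
    have hmem := (mem_circle_iff (z₀ := z₀) (v₀ := v₀) ha hb₀ (circleMap z₀ R t, (v₀ : ℂ))).1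
      ⟨by simp [circleMap, hRdef], rfl⟩
    have hp : (circleMap z₀ R t, (v₀ : ℂ)) ∈ frontier (domainOmega a b z₀ v₀) := by
      rw [hr.frontier_eq]; exact hmem.1
    obtain ⟨c, hc, h⟩ := hr.exists_complexHessian_eq hρ hp
    have h1 := (isHolTangent_omegaFun_iff a b z₀ v₀ _ L).1 ((h L).1.1 hT)
    have hL1 : L.1 = 0 := by
      simpa [omegaForm, ha.ne', hR.ne', circleMap] using h1
    have hL2 : L.2 ≠ 0 := fun h => hL (Prod.ext hL1 h)
    rw [(hderiv t).deriv, IsTransversal, Fintype.linearIndependent_iff]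
    intro k hk
    rw [Fin.sum_univ_three] at hk
    change k 0 • (_ : ℂ × ℂ) + k 1 • holRe L + k 2 • holIm L = 0 at hk
    simp only [holRe, holIm, Prod.ext_iff, Prod.fst_add, Prod.snd_add, Prod.smul_fst,
      Prod.smul_snd, hL1, smul_zero, add_zero, Matrix.cons_val_zero, Prod.fst_zero, Prod.snd_zero,
      smul_eq_mul, Complex.real_smul, mul_zero] at hk
    have hk0 : k 0 = 0 := by
      simpa [hne t] using hk.1
    -- The velocity lies in the `z`-direction and `L` in the `w`-direction, so the relation
    -- decouples; `Re L` and `Im L` combine to a complex multiple of `L.2`.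
    have hk1 : ((k 1 : ℂ) - k 2 * Complex.I) * L.2 = 0 := by
      linear_combination 2 * hk.2
    have hk2 := (mul_eq_zero.1 hk1).resolve_right hL2
    rw [Complex.ext_iff] at hk2
    simp at hk2
    intro i
    fin_cases i
    · exact hk0
    · exact hk2.1
    · exact hk2.2

theorem dfIndex_domainOmega (ha : 0 < a) (hb₀ : 0 < b) (hb₂ : b < 2) :
    dfIndex (domainOmega a b z₀ v₀) = 1 := by
  have hr := isDefiningFunction_omegaFun (z₀ := z₀) (v₀ := v₀) ha hb₀
  have hK : 0 < (2 - b)⁻¹ := inv_pos.2 (by linarith)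
  have : {τ | IsDFExponent (domainOmega a b z₀ v₀) τ} = Set.Ioo 0 1 := by
    ext τ
    refine ⟨fun h => ⟨h.1, h.2.1⟩, fun h => ⟨h.1, h.2, _, hr.exp_sub_one hK, ?_⟩⟩
    rw [domainOmega_eq]
    refine isPlurisubharmonicOn_neg_rpow (hr.smooth.of_le (by norm_cast)) hK h.1 h.2.le
      fun p hp v => ?_
    rw [fderiv_fderiv_omegaFun_add, fderiv_omegaFun_eq_re, fderiv_omegaFun_I_smul]
    have h1 := omegaHess_add_nonneg ha hb₂ hp.le v
    rw [Complex.sq_norm, Complex.normSq_apply] at h1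
    linarith
  rw [dfIndex, this, csSup_Ioo zero_lt_one]

end OmegaDomain

theorem mainTheorem5 (z₀ : ℂ) (v₀ a b : ℝ) (ha : 0 < a) (hb₀ : 0 < b) (hb₂ : b < 2) :
    IsBoundedSmoothDomain (domainOmega a b z₀ v₀) ∧
    (∀ ρ : ℂ × ℂ → ℝ, IsDefiningFunction (domainOmega a b z₀ v₀) ρ →
      IsLeviPseudoconvex (domainOmega a b z₀ v₀) ρ ∧
      leviFlatSet (domainOmega a b z₀ v₀) ρ =
        {p : ℂ × ℂ | ‖p.1 - z₀‖ = Real.sqrt (b / a) ∧ p.2 = (v₀ : ℂ)} ∧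
      ∃ (γ : ℝ → ℂ × ℂ) (T : ℝ),
        IsSimpleClosedParam γ T (leviFlatSet (domainOmega a b z₀ v₀) ρ) ∧
        ∀ (t : ℝ) (L : ℂ × ℂ), L ≠ 0 → IsHolTangent ρ (γ t) L →
          IsTransversal (deriv γ t) L) ∧
    dfIndex (domainOmega a b z₀ v₀) = 1 := by
  refine ⟨isBoundedSmoothDomain_domainOmega ha hb₀ hb₂, fun ρ hρ => ?_,
    dfIndex_domainOmega ha hb₀ hb₂⟩
  rw [leviFlatSet_domainOmega ha hb₀ hb₂ hρ]
  exact ⟨isLeviPseudoconvex_domainOmega ha hb₀ hb₂ hρ, rfl,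
    exists_isSimpleClosedParam_circle ha hb₀ hρ⟩
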